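/- Let $\Bbbk$ be an algebraically closed field of any characteristic, $W$ a finite-dimensional $\Bbbk$-vector space, and $\mathbb{P}(W)=(W\setminus\{0\})/\Bbbk^*=\operatorname{Proj}\operatorname{Sym}(W^*)$. For a subscheme $R\subset\mathbb{P}(W)$ let the linear span $\langle R\rangle\subset\mathbb{P}(W)$ be the common zero locus of all linear forms $\ell\in W^*$ that vanish scheme-theoretically on $R$. For a locally closed subscheme $X\subset\mathbb{P}(W)$ and an integer $r\ge 0$, let the $r$-th cactus variety of $X$ be the Zariski closure $$\kappa_r(X)=\overline{\bigcup\{\langle R\rangle \mid R\subset X \text{ a finite subscheme of degree at most } r\}}\subset\mathbb{P}(W),$$ where the degree of $R$ is $\dim_{\Bbbk}\Gamma(R,\mathcal{O}_R)$. Let $M$ be a matrix whose entries are linear forms on $W$ (elements of $W^*$). For an integer $q \geq 0$ let $\{\operatorname{rk}M\le q\}\subset\mathbb{P}(W)$ be the locus where $M$ has rank at most $q$, with the closed subscheme structure defined by the $(q+1)\times(q+1)$ minors of $M$; put $\{\operatorname{rk}M\le -1\}=\emptyset$. Let $k\ge 0$ be an integer. **Theorem.** If $X\subset\mathbb{P}(W)$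 is a locally closed subscheme (not necessarily reduced) contained, as a subscheme, in the locally closed subscheme $$\{\operatorname{rk}M=k\}=\{\operatorname{rk}M\le k\}\setminus\{\operatorname{rk}M\le k-1\}\subset\mathbb{P}(W),$$ that is, all $(k+1)\times(k+1)$ minors of $M$ vanish scheme-theoretically on $X$ and $M$ has rank exactly $k$ at every point of $X$, then for every integer $r\ge 0$ $$\kappa_r(X)\subset\{\operatorname{rk}M\le k\cdot r\}.$$ -/

import Mathlib

open CategoryTheory AlgebraicGeometry Module

universe u

noncomputable section

namespace Cactus

/-! ### The projective space `ℙ(W) = (W ∖ 0) / 𝕜ˣ` as a scheme -/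

section ProjectiveSpace

variable (𝕜 W : Type u) [Field 𝕜] [AddCommGroup W] [Module 𝕜 W]

/-- The homogeneous coordinate ring `Sym (W*)` of `ℙ(W)`. -/
abbrev CoordRing : Type u := SymmetricAlgebra 𝕜 (Dual 𝕜 W)

/-- A linear form on `W`, as an element of the coordinate ring. -/
abbrev ofLinearForm : Dual 𝕜 W →ₗ[𝕜] CoordRing 𝕜 W := SymmetricAlgebra.ι 𝕜 (Dual 𝕜 W)

/-- `forms 𝕜 W d` is the space `Sym^d (W*)` of forms of degree `d`, spanned by the products of
`d` linear forms. -/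
abbrev forms (d : ℕ) : Submodule 𝕜 (CoordRing 𝕜 W) :=
  LinearMap.range (ofLinearForm 𝕜 W) ^ d

lemma ofLinearForm_mem (l : Dual 𝕜 W) : ofLinearForm 𝕜 W l ∈ forms 𝕜 W 1 := by
  simpa only [forms, pow_one] using LinearMap.mem_range_self _ l

/-- Auxiliary map used to decompose an element of `Sym (W*)` into its homogeneous components. -/
def gradedι : Dual 𝕜 W →ₗ[𝕜] DirectSum ℕ (fun d => forms 𝕜 W d) :=
  DirectSum.lof 𝕜 ℕ (fun d => forms 𝕜 W d) 1 ∘ₗ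
    (ofLinearForm 𝕜 W).codRestrict _ (ofLinearForm_mem 𝕜 W)

lemma gradedι_apply (l : Dual 𝕜 W) :
    gradedι 𝕜 W l = DirectSum.of (fun d => forms 𝕜 W d) 1
      ⟨ofLinearForm 𝕜 W l, ofLinearForm_mem 𝕜 W l⟩ := rfl

/-- The grading of `Sym (W*)` by degree. -/
instance gradedAlgebra : GradedAlgebra (forms 𝕜 W) :=
  GradedAlgebra.ofAlgHom _ (SymmetricAlgebra.lift (gradedι 𝕜 W))
    (by
      ext m
      change DirectSum.coeAlgHom (forms 𝕜 W)
        (SymmetricAlgebra.lift (gradedι 𝕜 W) (SymmetricAlgebra.ι 𝕜 (Dual 𝕜 W) m)) =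
        SymmetricAlgebra.ι 𝕜 (Dual 𝕜 W) m
      rw [SymmetricAlgebra.lift_ι_apply, gradedι_apply, DirectSum.coeAlgHom_of])
    fun i x => by
      obtain ⟨x, hx⟩ := x
      dsimp only [Subtype.coe_mk, DirectSum.lof_eq_of]
      induction hx using Submodule.pow_induction_on_left' with
      | algebraMap r =>
        rw [AlgHom.commutes, DirectSum.algebraMap_apply]; rfl
      | add x y i hx hy ihx ihy =>
        rw [map_add, ihx, ihy, ← map_add]
        rfl
      | mem_mul m hm i x hx ih =>
        obtain ⟨_, rfl⟩ := hm
        rw [map_mul, ih, SymmetricAlgebra.lift_ι_apply, gradedι_apply, DirectSum.of_mul_of]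
        exact DirectSum.of_eq_of_gradedMonoid_eq (Sigma.subtype_ext (add_comm _ _) rfl)

/-- The projective space `ℙ(W)` of lines in `W`: the scheme `Proj (Sym (W*))`. -/
abbrev ProjSpace : Scheme.{u} := Proj (forms 𝕜 W)

/-- The structure morphism `ℙ(W) ⟶ Spec 𝕜`. -/
def ProjSpace.toSpec : ProjSpace 𝕜 W ⟶ Spec (.of 𝕜) :=
  Proj.toSpecZero (forms 𝕜 W) ≫
    Spec.map (CommRingCat.ofHom (algebraMap 𝕜 (forms 𝕜 W 0)))

end ProjectiveSpace

variable {𝕜 W : Type u} [Field 𝕜] [AddCommGroup W] [Module 𝕜 W]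

/-- The form `f` of degree `d` vanishes (scheme-theoretically) on `j : Z ⟶ ℙ(W)`: for each form
`g` of degree `d`, the pullback along `j` of the regular function `f / g` on `{g ≠ 0}` is zero.
(The sets `{g ≠ 0}` cover `ℙ(W)`, so that this is the vanishing of the pullback of the section
`f` of `𝒪(d)`.) -/
def VanishesOn {d : ℕ} (f : forms 𝕜 W d) {Z : Scheme.{u}} (j : Z ⟶ ProjSpace 𝕜 W) : Prop :=
  ∀ g : forms 𝕜 W d,
    (j.app (Proj.basicOpen (forms 𝕜 W) g.1)).hom
      ((Proj.awayToSection (forms 𝕜 W) g.1).hom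
        (HomogeneousLocalization.Away.mk (forms 𝕜 W) g.2 1 f.1
          (by simpa only [one_smul] using f.2))) = 0

/-- A linear form on `W`, as a form of degree `1`. -/
def linearForm (l : Dual 𝕜 W) : forms 𝕜 W 1 := ⟨ofLinearForm 𝕜 W l, ofLinearForm_mem 𝕜 W l⟩

/-- The linear span `⟨Z⟩ ⊆ ℙ(W)` of `j : Z ⟶ ℙ(W)`: the common zero locus of all the linear forms
that vanish scheme-theoretically on `Z`. -/
def linSpan {Z : Scheme.{u}} (j : Z ⟶ ProjSpace 𝕜 W) : Set (ProjSpace 𝕜 W) :=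
  {p | ∀ l : Dual 𝕜 W, VanishesOn (linearForm l) j → ofLinearForm 𝕜 W l ∈ p.asHomogeneousIdeal}

/-- The degree `dim_𝕜 Γ(R, 𝒪_R)` of a finite scheme `R` over `𝕜`. -/
def degree {R : Scheme.{u}} (s : R ⟶ Spec (.of 𝕜)) : ℕ :=
  letI : Algebra 𝕜 Γ(R, ⊤) := ((Scheme.ΓSpecIso (.of 𝕜)).inv ≫ s.appTop).hom.toAlgebra
  Module.finrank 𝕜 Γ(R, ⊤)

/-- The union of the linear spans `⟨R⟩` of all the finite subschemes `R ⊆ X` of degree at most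
`r`, where `X` is a subscheme of `ℙ(W)` through `j`. -/
def cactusOpen (r : ℕ) {X : Scheme.{u}} (j : X ⟶ ProjSpace 𝕜 W) : Set (ProjSpace 𝕜 W) :=
  {p | ∃ (R : Scheme.{u}) (i : R ⟶ X), IsClosedImmersion i ∧
    IsFinite (i ≫ j ≫ ProjSpace.toSpec 𝕜 W) ∧
    degree (i ≫ j ≫ ProjSpace.toSpec 𝕜 W) ≤ r ∧ p ∈ linSpan (i ≫ j)}

/-- The `r`-th cactus variety of `X`: the Zariski closure of `cactusOpen`. -/
def cactus (r : ℕ) {X : Scheme.{u}} (j : X ⟶ ProjSpace 𝕜 W) : Set (ProjSpace 𝕜 W) :=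
  closure (cactusOpen r j)

section Matrices

variable {m n : Type*}

/-- The `q × q` minor of a matrix of linear forms with rows `a` and columns `b`, a form of
degree `q`. -/
def minor (M : Matrix m n (Dual 𝕜 W)) {q : ℕ} (a : Fin q ↪ m) (b : Fin q ↪ n) : forms 𝕜 W q :=
  ⟨((M.map (ofLinearForm 𝕜 W)).submatrix a b).det, by
    rw [Matrix.det_apply]
    refine Submodule.sum_mem _ fun σ _ => ?_
    rw [Units.smul_def]
    refine zsmul_mem ?_ _
    have h := SetLike.prod_mem_graded (A := forms 𝕜 W) (F := (Finset.univ : Finset (Fin q)))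
      (fun _ => 1) (fun i => (M.map (ofLinearForm 𝕜 W)).submatrix a b (σ i) i)
      (fun i _ => ofLinearForm_mem 𝕜 W _)
    simpa using h⟩

/-- The rank at the point `p` of `ℙ(W)` of a matrix of linear forms, that is, the rank of the
matrix over the residue field of the homogeneous prime ideal `p`. -/
def rankAt [Fintype n] (M : Matrix m n (Dual 𝕜 W)) (p : ProjSpace 𝕜 W) : ℕ :=
  haveI : p.asHomogeneousIdeal.toIdeal.IsPrime := p.isPrime
  (M.map fun l => algebraMap (CoordRing 𝕜 W) p.asHomogeneousIdeal.toIdeal.ResidueField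
    (ofLinearForm 𝕜 W l)).rank

/-- The rank locus `{rk M ≤ q}` as a subset of `ℙ(W)`. -/
def rankLocus [Fintype n] (M : Matrix m n (Dual 𝕜 W)) (q : ℕ) : Set (ProjSpace 𝕜 W) :=
  {p | rankAt M p ≤ q}

/-- `j : X ⟶ ℙ(W)` factors through the locally closed subscheme
`{rk M = k} = {rk M ≤ k} ∖ {rk M ≤ k - 1}`, where the closed subscheme `{rk M ≤ k}` is defined by
the `(k + 1) × (k + 1)` minors of `M`. The containment is scheme-theoretic: `X` may be
non-reduced. -/
def InConstantRankLocus [Fintype n] (M : Matrix m n (Dual 𝕜 W)) (k : ℕ) {X : Scheme.{u}}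
    (j : X ⟶ ProjSpace 𝕜 W) : Prop :=
  (∀ (a : Fin (k + 1) ↪ m) (b : Fin (k + 1) ↪ n), VanishesOn (minor M a b) j) ∧
    ∀ x : X, rankAt M (j x) = k

end Matrices

end Cactus

end

/-! Let `R ⊆ X` be finite of degree at most `r`, with `A = Γ(R, ⊤)`, a finite-dimensional
`𝕜`-algebra. As `𝕜` is infinite, some linear form `g` has no zero on `R`; division by `g` gives a
`𝕜`-linear map `φ : W* → A` whose kernel is the space of linear forms vanishing on `R`. Hence `p ∈
⟨R⟩` says exactly that evaluation of linear forms in the residue field at `p` kills `ker φ`, so it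
is `f ∘ φ` for some linear `f` on `A`.

The minors of size `k + 1` of `φ(M)` vanish in `A` itself, nilpotents included, and some minor of
size `k` is nonzero at each prime. As `A` is a product of local rings, `φ(M) = P * Q` with inner
size `k` (`exists_eq_mul_of_isArtinianRing`). Writing `Q` in a `𝕜`-basis of `A` factors `f(P * Q)`
through dimension `k * dim A` (`rank_map_mul_le`). This bounds the rank on each span
(`rankAt_le_of_mem_linSpan`); since rank loci are closed, the bound passes to the closure. -/

namespace Cactus

/-! ### Rank and factorization of matrices. -/

section LinearAlgebra

variable {m n : Type*}

/-- If all the minors of size `q` with distinct rows and distinct columns vanish, then so do those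
with repetitions. -/
lemma det_submatrix_eq_zero {A : Type*} [CommRing A] (M : Matrix m n A) {q : ℕ}
    (h : ∀ (a : Fin q ↪ m) (b : Fin q ↪ n), (M.submatrix a b).det = 0)
    (a : Fin q → m) (b : Fin q → n) : (M.submatrix a b).det = 0 := by
  by_cases ha : Function.Injective a
  · by_cases hb : Function.Injective b
    · exact h ⟨a, ha⟩ ⟨b, hb⟩
    · simp only [Function.Injective, not_forall] at hb
      obtain ⟨s, t, hst, hne⟩ := hb
      exact Matrix.det_zero_of_column_eq hne fun i => by simp [hst]
  · simp only [Function.Injective, not_forall] at ha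
    obtain ⟨s, t, hst, hne⟩ := ha
    exact Matrix.det_zero_of_row_eq hne (by ext i; simp [hst])

/-- A matrix with an invertible minor of size `k` whose minors of size `k + 1` vanish factors
through a free module of rank `k`. -/
lemma exists_eq_mul_of_isUnit_minor {A : Type*} [CommRing A] (M : Matrix m n A) {k : ℕ}
    (h : ∀ (a : Fin (k + 1) ↪ m) (b : Fin (k + 1) ↪ n), (M.submatrix a b).det = 0)
    (a : Fin k → m) (b : Fin k → n) (hu : IsUnit (M.submatrix a b).det) :
    ∃ (P : Matrix m (Fin k) A) (Q : Matrix (Fin k) n A), M = P * Q := by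
  have hU : IsUnit (M.submatrix a b) := (Matrix.isUnit_iff_isUnit_det _).2 hu
  let := hU.invertible
  refine ⟨M.submatrix id b, ⅟(M.submatrix a b) * M.submatrix a id, ?_⟩
  ext i j
  -- Border the invertible block by row `i` and column `j`: the Schur complement of that block is a
  -- `1 × 1` matrix, and it must vanish. This is the `(i, j)` entry of the factorization.
  have key := det_submatrix_eq_zero M h (Sum.elim a (fun _ : Fin 1 => i) ∘ finSumFinEquiv.symm)
    (Sum.elim b (fun _ : Fin 1 => j) ∘ finSumFinEquiv.symm)
  rw [← Matrix.submatrix_submatrix, Matrix.det_submatrix_equiv_self] at key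
  have hb : M.submatrix (Sum.elim a fun _ : Fin 1 => i) (Sum.elim b fun _ : Fin 1 => j) =
      Matrix.fromBlocks (M.submatrix a b) (M.submatrix a fun _ => j)
        (M.submatrix (fun _ => i) b) (M.submatrix (fun _ => i) fun _ => j) := by
    ext (s | s) (t | t) <;> rfl
  rw [hb, Matrix.det_fromBlocks₁₁] at key
  have key' := (hu.mul_right_eq_zero).1 key
  rw [Matrix.det_unique, Matrix.sub_apply, sub_eq_zero] at key'
  rw [← Matrix.mul_assoc]
  exact key'

/-- Over an Artinian ring, a matrix of constant rank `k` (scheme-theoretically) factors through a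
free module of rank `k`. -/
lemma exists_eq_mul_of_isArtinianRing {A : Type*} [CommRing A] [IsArtinianRing A]
    (M : Matrix m n A) {k : ℕ}
    (h : ∀ (a : Fin (k + 1) ↪ m) (b : Fin (k + 1) ↪ n), (M.submatrix a b).det = 0)
    (hk : ∀ p : PrimeSpectrum A, ∃ (a : Fin k → m) (b : Fin k → n),
      (M.submatrix a b).det ∉ p.asIdeal) :
    ∃ (P : Matrix m (Fin k) A) (Q : Matrix (Fin k) n A), M = P * Q := by
  have hloc : ∀ p : PrimeSpectrum A, ∃ (P : Matrix m (Fin k) (Localization.AtPrime p.asIdeal))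
      (Q : Matrix (Fin k) n (Localization.AtPrime p.asIdeal)),
      M.map (algebraMap A (Localization.AtPrime p.asIdeal)) = P * Q := by
    intro p
    obtain ⟨a, b, hab⟩ := hk p
    have hdet : ∀ {q : ℕ} (a : Fin q → m) (b : Fin q → n),
        ((M.map (algebraMap A (Localization.AtPrime p.asIdeal))).submatrix a b).det =
        algebraMap A _ (M.submatrix a b).det := fun a b => by
      rw [RingHom.map_det, RingHom.mapMatrix_apply, Matrix.submatrix_map]
    refine exists_eq_mul_of_isUnit_minor _ (fun a b => ?_) a b ?_
    · rw [hdet, h, map_zero]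
    · rw [hdet]
      exact IsLocalization.map_units (M := p.asIdeal.primeCompl) _ ⟨_, hab⟩
  choose P Q hPQ using hloc
  -- An Artinian ring is the product of its localizations at primes; the inner size `k` is the same
  -- in every factor, so the local factorizations assemble.
  let e := RingEquiv.ofBijective (PrimeSpectrum.toPiLocalization A)
    PrimeSpectrum.toPiLocalization_bijective
  refine ⟨Matrix.of fun i s => e.symm fun p => P p i s,
    Matrix.of fun s j => e.symm fun p => Q p s j, ?_⟩
  ext i j
  apply e.injective
  simp only [Matrix.mul_apply, Matrix.of_apply, map_sum, map_mul, RingEquiv.apply_symm_apply]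
  funext p
  rw [Finset.sum_apply]
  exact congr_fun (congr_fun (hPQ p) i) j

/-- Let `M = P * Q` be a matrix over a finite `𝕜`-algebra `A` that factors through `A ^ k`. The
image of `M` under a `𝕜`-linear map from `A` to a field has rank at most `k * dim A`. -/
lemma rank_map_mul_le {𝕜 A K : Type*} [Field 𝕜] [CommRing A] [Algebra 𝕜 A] [Module.Finite 𝕜 A]
    [Field K] [Algebra 𝕜 K] [Fintype m] [Fintype n] {k : ℕ} (P : Matrix m (Fin k) A)
    (Q : Matrix (Fin k) n A) (f : A →ₗ[𝕜] K) : ((P * Q).map f).rank ≤ k * finrank 𝕜 A := by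
  let e := Module.finBasis 𝕜 A
  -- `f` need not be multiplicative, but it commutes with scalars: only the coordinates of `Q` in
  -- the basis `e` are pulled out of it.
  have : (P * Q).map f =
      (Matrix.of fun i (x : Fin k × Fin (finrank 𝕜 A)) => f (P i x.1 * e x.2)) *
        (Matrix.of fun (x : Fin k × Fin (finrank 𝕜 A)) j =>
          algebraMap 𝕜 K (e.repr (Q x.1 j) x.2)) := by
    ext i j
    simp only [Matrix.map_apply, Matrix.mul_apply, map_sum, Matrix.of_apply,
      Fintype.sum_prod_type]
    refine Finset.sum_congr rfl fun s _ => ?_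
    conv_lhs => rw [← e.sum_repr (Q s j), Finset.mul_sum, map_sum]
    refine Finset.sum_congr rfl fun t _ => ?_
    rw [mul_smul_comm, map_smul, Algebra.smul_def, mul_comm]
  rw [this]
  refine (Matrix.rank_mul_le_left _ _).trans ((Matrix.rank_le_card_width _).trans ?_)
  simp

/-- A matrix of rank at least `q` over a field has `q` linearly independent columns. -/
lemma exists_linearIndependent_col {K : Type*} [Field K] [Finite m] [Fintype n] (M : Matrix m n K)
    {q : ℕ} (hq : q ≤ M.rank) : ∃ b : Fin q → n, LinearIndependent K fun s => M.col (b s) := by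
  rw [Matrix.rank_eq_finrank_span_cols] at hq
  obtain ⟨f, hf, -, hli⟩ := Submodule.exists_fun_fin_finrank_span_eq K (Set.range M.col)
  choose b hb using hf
  refine ⟨b ∘ Fin.castLE hq, ?_⟩
  have : (fun s => M.col ((b ∘ Fin.castLE hq) s)) = f ∘ Fin.castLE hq := by
    funext s
    exact hb _
  rw [this]
  exact hli.comp _ (Fin.castLE_injective hq)

/-- A matrix over a field has rank at least `q` if and only if it has a nonzero minor of
size `q`. -/
lemma le_rank_iff_exists_minor {K : Type*} [Field K] [Fintype m] [Fintype n] (M : Matrix m n K)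
    (q : ℕ) : q ≤ M.rank ↔ ∃ (a : Fin q ↪ m) (b : Fin q ↪ n), (M.submatrix a b).det ≠ 0 := by
  constructor
  · intro hq
    obtain ⟨b, hb⟩ := exists_linearIndependent_col M hq
    have h1 : (M.submatrix id b).transpose.rank = q := by
      have := LinearIndependent.rank_matrix (M := (M.submatrix id b).transpose) hb
      simpa using this
    -- Columns of the transpose: this selects independent rows among the columns already chosen.
    obtain ⟨a, ha⟩ := exists_linearIndependent_col _ h1.ge
    have hdet : (M.submatrix a b).det ≠ 0 := by
      have : IsUnit (M.submatrix a b) := Matrix.linearIndependent_rows_iff_isUnit.1 ha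
      exact ((Matrix.isUnit_iff_isUnit_det _).1 this).ne_zero
    by_contra! h
    exact hdet (det_submatrix_eq_zero M h a b)
  · rintro ⟨a, b, hab⟩
    have := Matrix.rank_of_det_ne_zero hab
    rw [Fintype.card_fin] at this
    exact this.ge.trans (Matrix.rank_submatrix_le _ _ _)

/-- A linear map whose kernel contains that of `f` factors through `f`. -/
lemma exists_comp_eq_of_ker_le {K V V' V'' : Type*} [Field K] [AddCommGroup V] [Module K V]
    [AddCommGroup V'] [Module K V'] [AddCommGroup V''] [Module K V''] (f : V →ₗ[K] V')
    (g : V →ₗ[K] V'') (h : LinearMap.ker f ≤ LinearMap.ker g) :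
    ∃ l : V' →ₗ[K] V'', l ∘ₗ f = g := by
  obtain ⟨s, hs⟩ := ((LinearMap.ker f).liftQ f le_rfl).exists_leftInverse_of_injective
    (Submodule.ker_liftQ_eq_bot _ _ _ le_rfl)
  refine ⟨(LinearMap.ker f).liftQ g h ∘ₗ s, ?_⟩
  ext v
  have := LinearMap.congr_fun hs (Submodule.Quotient.mk v)
  simp only [LinearMap.comp_apply, Submodule.liftQ_apply, LinearMap.id_apply] at this ⊢
  rw [this, Submodule.liftQ_apply]

end LinearAlgebra

variable {𝕜 W : Type u} [Field 𝕜] [AddCommGroup W] [Module 𝕜 W]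

/-! ### Forms at points of projective space. -/

/-- Some linear form does not vanish at a given point of `ℙ(W)`. -/
lemma exists_linearForm_notMem (p : ProjSpace 𝕜 W) :
    ∃ l : Dual 𝕜 W, ofLinearForm 𝕜 W l ∉ p.asHomogeneousIdeal := by
  by_contra! h
  have h1 : ∀ d, ∀ x ∈ forms 𝕜 W (d + 1), x ∈ p.asHomogeneousIdeal.toIdeal := by
    intro d x hx
    rw [forms, pow_succ] at hx
    refine Submodule.mul_induction_on hx ?_ fun _ _ => add_mem
    rintro y - _ ⟨l, rfl⟩
    exact Ideal.mul_mem_left _ _ (h l)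
  -- If every linear form lay in `p`, so would all forms of positive degree, hence the irrelevant
  -- ideal.
  refine p.not_irrelevant_le fun x hx => ?_
  classical
  rw [← DirectSum.sum_support_decompose (forms 𝕜 W) x]
  refine sum_mem fun d hd => ?_
  obtain _ | d := d
  · rw [DFinsupp.mem_support_iff] at hd
    refine absurd (Subtype.ext ?_) hd
    simpa [GradedRing.proj_apply] using (HomogeneousIdeal.mem_irrelevant_iff _ _).1 hx
  · exact h1 d _ (SetLike.coe_mem _)

/-- A minor vanishes in the residue field at `p` if and only if it lies in the prime ideal `p`. -/
lemma det_residueField_eq_zero_iff {m n : Type*} (M : Matrix m n (Dual 𝕜 W))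
    (p : ProjSpace 𝕜 W) [p.asHomogeneousIdeal.toIdeal.IsPrime] {q : ℕ} (a : Fin q ↪ m)
    (b : Fin q ↪ n) :
    ((M.map fun l => algebraMap (CoordRing 𝕜 W) p.asHomogeneousIdeal.toIdeal.ResidueField
      (ofLinearForm 𝕜 W l)).submatrix a b).det = 0 ↔ (minor M a b).1 ∈ p.asHomogeneousIdeal := by
  rw [← HomogeneousIdeal.mem_iff, ← Ideal.algebraMap_residueField_eq_zero, minor, RingHom.map_det,
    RingHom.mapMatrix_apply, Matrix.submatrix_map]
  rfl

lemma VanishesOn.comp {d : ℕ} {f : forms 𝕜 W d} {X R : Scheme.{u}} {j : X ⟶ ProjSpace 𝕜 W}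
    (h : VanishesOn f j) (i : R ⟶ X) : VanishesOn f (i ≫ j) := by
  intro g
  have := congrArg (i.app _).hom (h g)
  rw [map_zero] at this
  rw [Scheme.Hom.comp_app]
  exact this

/-! ### Dehomogenization by a linear form and pullback to `R`. -/

open HomogeneousLocalization

/-- The regular function `f / g ^ d` on `{g ≠ 0}`. -/
noncomputable abbrev quot (g : forms 𝕜 W 1) {d : ℕ} (f : forms 𝕜 W d) : Away (forms 𝕜 W) g.1 :=
  Away.mk (forms 𝕜 W) g.2 d f.1 (by simpa only [smul_eq_mul, mul_one] using f.2)

/-- Pulling back regular functions along `z` commutes with restriction from `{f ≠ 0}` to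
`{f * g ≠ 0}`. -/
lemma app_awayToSection_awayMap {R : Scheme.{u}} (z : R ⟶ ProjSpace 𝕜 W) {e : ℕ}
    {f g x : CoordRing 𝕜 W} (hg : g ∈ forms 𝕜 W e) (hx : x = f * g)
    (a : Away (forms 𝕜 W) f) :
    (z.app (Proj.basicOpen (forms 𝕜 W) x)).hom
      ((Proj.awayToSection (forms 𝕜 W) x).hom (awayMap (forms 𝕜 W) hg hx a)) =
    (R.presheaf.map (homOfLE (z.preimage_mono
        (Proj.basicOpen_mono (forms 𝕜 W) _ _ ⟨g, hx⟩))).op).hom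
      ((z.app (Proj.basicOpen (forms 𝕜 W) f)).hom
        ((Proj.awayToSection (forms 𝕜 W) f).hom a)) := by
  have h := congrArg (fun φ => (z.app _).hom (φ.hom a))
    (Proj.awayMap_awayToSection (forms 𝕜 W) hg hx)
  refine h.trans ?_
  exact congrArg (fun φ => φ.hom ((Proj.awayToSection (forms 𝕜 W) f).hom a))
    (z.naturality (homOfLE (Proj.basicOpen_mono (forms 𝕜 W) _ _ ⟨g, hx⟩)).op)

/-- Allows comparison of sections over preimages of `{g ≠ 0}` and `{g * g' ≠ 0}` that are equal, but
not definitionally. -/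
lemma presheaf_map_eq_zero_iff {R : Scheme.{u}} {U V : R.Opens} (h : U = V) (i : U ⟶ V)
    (s : Γ(R, V)) : (R.presheaf.map i.op).hom s = 0 ↔ s = 0 := by
  subst h
  rw [Subsingleton.elim i (𝟙 U), op_id, R.presheaf.map_id]
  rfl

/-- If `g` is a linear form without zeros on `Z`, then `f` vanishes on `Z` if and only if the
pullback of the single function `f / g ^ d` is zero. -/
lemma vanishesOn_iff {R : Scheme.{u}} (z : R ⟶ ProjSpace 𝕜 W) (g : forms 𝕜 W 1)
    (hg : z ⁻¹ᵁ Proj.basicOpen (forms 𝕜 W) g.1 = ⊤) {d : ℕ} (f : forms 𝕜 W d) :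
    VanishesOn f z ↔ (z.app (Proj.basicOpen (forms 𝕜 W) g.1)).hom
      ((Proj.awayToSection (forms 𝕜 W) g.1).hom (quot g f)) = 0 := by
  have hmul : ∀ g' : CoordRing 𝕜 W, z ⁻¹ᵁ Proj.basicOpen (forms 𝕜 W) (g.1 * g') =
      z ⁻¹ᵁ Proj.basicOpen (forms 𝕜 W) g' := by
    intro g'
    rw [Proj.basicOpen_mul, Scheme.Hom.preimage_inf, hg, top_inf_eq]
  constructor
  · intro h
    have hgd : g.1 ^ d ∈ forms 𝕜 W d := by
      simpa using SetLike.pow_mem_graded d g.2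
    have h0 := h ⟨g.1 ^ d, hgd⟩
    rw [← presheaf_map_eq_zero_iff (V := z ⁻¹ᵁ Proj.basicOpen (forms 𝕜 W) g.1) (U :=
      z ⁻¹ᵁ Proj.basicOpen (forms 𝕜 W) (g.1 * g.1 ^ d)) _ (homOfLE (z.preimage_mono
        (Proj.basicOpen_mono (forms 𝕜 W) _ _ ⟨_, rfl⟩))), ← app_awayToSection_awayMap z hgd rfl]
    · have h1 := app_awayToSection_awayMap z g.2 (mul_comm g.1 (g.1 ^ d))
        (Away.mk (forms 𝕜 W) hgd 1 f.1 (by simpa only [one_smul] using f.2))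
      rw [h0, map_zero] at h1
      rw [← h1]
      congr 2
      ext
      simp only [quot, awayMap_mk, Away.val_mk]
      rw [Localization.mk_eq_mk_iff, Localization.r_iff_exists]
      exact ⟨1, by simp only [OneMemClass.coe_one]; ring⟩
    · rw [hmul, hg]
      -- The locus `{g ^ d ≠ 0}` equals `{g ≠ 0}` only for `d > 0`; for `d = 0` it is the whole
      -- space.
      by_cases hd : d = 0
      · subst hd
        simp
      · rw [Proj.basicOpen_pow _ _ _ (Nat.pos_of_ne_zero hd), hg]
  · intro h g'
    rw [← presheaf_map_eq_zero_iff (hmul g'.1) (homOfLE (z.preimage_mono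
        (Proj.basicOpen_mono (forms 𝕜 W) _ _ ⟨_, mul_comm _ _⟩))),
      ← app_awayToSection_awayMap z g.2 (mul_comm g.1 g'.1)]
    have hgd : g.1 ^ d ∈ forms 𝕜 W d := by
      simpa using SetLike.pow_mem_graded d g.2
    -- On `{g * g' ≠ 0}` one has `f / g' = (f / g ^ d) * (g ^ d / g')`.
    have key : awayMap (forms 𝕜 W) g.2 (mul_comm g.1 g'.1)
          (Away.mk (forms 𝕜 W) g'.2 1 f.1 (by simpa only [one_smul] using f.2)) =
        awayMap (forms 𝕜 W) g'.2 rfl (quot g f) *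
        awayMap (forms 𝕜 W) g.2 (mul_comm g.1 g'.1)
          (Away.mk (forms 𝕜 W) g'.2 1 (g.1 ^ d) (by simpa only [one_smul] using hgd)) := by
      ext
      simp only [quot, awayMap_mk, Away.val_mk, val_mul]
      rw [Localization.mk_mul, Localization.mk_eq_mk_iff, Localization.r_iff_exists]
      exact ⟨1, by simp only [OneMemClass.coe_one, Submonoid.coe_mul]; ring⟩
    rw [key, map_mul, map_mul, app_awayToSection_awayMap z g'.2 rfl, h, map_zero, zero_mul]

lemma comp_appLE_top {X Y Z : Scheme.{u}} (f : X ⟶ Y) (h : Y ⟶ Z) (U : Z.Opens)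
    (e : ⊤ ≤ h ⁻¹ᵁ U) : (f ≫ h).appLE U ⊤ (f.preimage_mono e) = h.appLE U ⊤ e ≫ f.appTop := by
  rw [Scheme.Hom.appTop, Scheme.Hom.app_eq_appLE]
  exact (Scheme.Hom.appLE_comp_appLE f h U ⊤ ⊤ e le_rfl).symm

lemma hom_appTop_inv_appTop {X Y : Scheme.{u}} (e : X ≅ Y) :
    e.hom.appTop ≫ e.inv.appTop = 𝟙 _ := by
  rw [← Scheme.Hom.comp_appTop, e.inv_hom_id, Scheme.Hom.id_appTop]

/-- The diagram chase for `awayToSection_appLE_awayι`: `i.hom ≫ c ≫ x = a ≫ e = 𝟙`. -/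
lemma comp_eq_inv {C : Type*} [Category C] {A B D E : C} (i : A ≅ B) {a : A ⟶ E} {c : B ⟶ D}
    {d : D ⟶ E} {e : E ⟶ A} {x : D ⟶ A} (h1 : a = i.hom ≫ c ≫ d) (h3 : x = d ≫ e)
    (h4 : a ≫ e = 𝟙 A) : c ≫ x = i.inv := by
  rw [h3, ← cancel_epi i.hom, Iso.hom_inv_id, ← h4, h1]
  simp only [Category.assoc]

/-- The chart `Spec (A_g)₀ ⟶ ℙ(W)` pulls an element of `(A_g)₀`, as a section, back to itself. -/
lemma awayToSection_appLE_awayι (g : forms 𝕜 W 1) (h) :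
    Proj.awayToSection (forms 𝕜 W) g.1 ≫
      (Proj.awayι (forms 𝕜 W) g.1 g.2 one_pos).appLE (Proj.basicOpen (forms 𝕜 W) g.1) ⊤ h =
    (Scheme.ΓSpecIso (.of (Away (forms 𝕜 W) g.1))).inv := by
  have h1 : (Proj.basicOpenIsoSpec (forms 𝕜 W) g.1 g.2 one_pos).hom.appTop =
      (Scheme.ΓSpecIso _).hom ≫ Proj.awayToSection (forms 𝕜 W) g.1 ≫
        (Proj.basicOpen (forms 𝕜 W) g.1).topIso.inv :=
    Proj.basicOpenToSpec_app_top (forms 𝕜 W) g.1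
  have h2 : (Proj.basicOpen (forms 𝕜 W) g.1).topIso.inv =
    (Proj.basicOpen (forms 𝕜 W) g.1).ι.appLE (Proj.basicOpen (forms 𝕜 W) g.1) ⊤ (by simp) := by
    rw [Scheme.Opens.ι_appLE, Scheme.Opens.topIso_inv]
    rfl
  have h3 : (Proj.awayι (forms 𝕜 W) g.1 g.2 one_pos).appLE (Proj.basicOpen (forms 𝕜 W) g.1) ⊤ h =
    (Proj.basicOpen (forms 𝕜 W) g.1).topIso.inv ≫
      (Proj.basicOpenIsoSpec (forms 𝕜 W) g.1 g.2 one_pos).inv.appTop := by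
    rw [h2]
    exact comp_appLE_top _ _ _ _
  exact comp_eq_inv _ h1 h3 (hom_appTop_inv_appTop _)

/-- The ring homomorphism from the functions on `{g ≠ 0}` to the global functions on `R` given by
a morphism `t` from `R` to `{g ≠ 0}`. -/
noncomputable def pullbackAway {R : Scheme.{u}} (g : forms 𝕜 W 1)
    (t : R ⟶ Spec (.of (Away (forms 𝕜 W) g.1))) : Away (forms 𝕜 W) g.1 →+* Γ(R, ⊤) :=
  ((Scheme.ΓSpecIso _).inv ≫ t.appTop).hom

variable {R : Scheme.{u}} (g : forms 𝕜 W 1) (t : R ⟶ Spec (.of (Away (forms 𝕜 W) g.1)))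

lemma preimage_basicOpen_eq_top :
    (t ≫ Proj.awayι (forms 𝕜 W) g.1 g.2 one_pos) ⁻¹ᵁ Proj.basicOpen (forms 𝕜 W) g.1 = ⊤ := by
  rw [← Proj.opensRange_awayι (forms 𝕜 W) g.1 g.2 one_pos, Scheme.Hom.comp_preimage,
    Scheme.Hom.preimage_opensRange]
  rfl

lemma vanishesOn_iff_pullbackAway {d : ℕ} (f : forms 𝕜 W d) :
    VanishesOn f (t ≫ Proj.awayι (forms 𝕜 W) g.1 g.2 one_pos) ↔
      pullbackAway g t (quot g f) = 0 := by
  have htop := preimage_basicOpen_eq_top g t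
  rw [vanishesOn_iff _ g htop, ← presheaf_map_eq_zero_iff htop.symm (homOfLE htop.ge)]
  have h : Proj.awayToSection (forms 𝕜 W) g.1 ≫
      (t ≫ Proj.awayι (forms 𝕜 W) g.1 g.2 one_pos).appLE _ ⊤ htop.ge =
      (Scheme.ΓSpecIso (.of (Away (forms 𝕜 W) g.1))).inv ≫ t.appTop := by
    have e : ⊤ ≤ Proj.awayι (forms 𝕜 W) g.1 g.2 one_pos ⁻¹ᵁ Proj.basicOpen (forms 𝕜 W) g.1 := by
      rw [← Proj.opensRange_awayι (forms 𝕜 W) g.1 g.2 one_pos, Scheme.Hom.preimage_opensRange]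
    rw [← awayToSection_appLE_awayι g e, comp_appLE_top t _ _ e, Category.assoc]
  have h' := congrArg (fun φ => φ.hom (quot g f)) h
  rw [pullbackAway, ← h']
  rfl

/-- `pullbackAway` is compatible with the structure morphisms to `Spec 𝕜`. -/
lemma pullbackAway_algebraMap (c : 𝕜) :
    pullbackAway g t (fromZeroRingHom (forms 𝕜 W) _ (algebraMap 𝕜 (forms 𝕜 W 0) c)) =
      ((Scheme.ΓSpecIso (.of 𝕜)).inv ≫ ((t ≫ Proj.awayι (forms 𝕜 W) g.1 g.2 one_pos) ≫
        ProjSpace.toSpec 𝕜 W).appTop).hom c := by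
  rw [ProjSpace.toSpec, Category.assoc, Proj.awayι_toSpecZero_assoc, ← Spec.map_comp,
    Scheme.Hom.comp_appTop, ← Category.assoc, ← Scheme.ΓSpecIso_inv_naturality]
  rfl

/-- Turns a minor that is nonzero at a point of `R` into an element of `Γ(R, ⊤)` outside the
corresponding prime. -/
lemma mem_basicOpen_pullbackAway {d : ℕ} (hd : 0 < d) (f : forms 𝕜 W d) (x : R) :
    x ∈ R.basicOpen (pullbackAway g t (quot g f)) ↔
      f.1 ∉ ((t ≫ Proj.awayι (forms 𝕜 W) g.1 g.2 one_pos) x).asHomogeneousIdeal := by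
  have : Away.isLocalizationElem g.2 f.2 = quot g f := by
    ext
    simp [quot]
  have h : (t ≫ Proj.awayι (forms 𝕜 W) g.1 g.2 one_pos) ⁻¹ᵁ Proj.basicOpen (forms 𝕜 W) f.1 =
      R.basicOpen (pullbackAway g t (quot g f)) := by
    rw [Scheme.Hom.comp_preimage, Proj.awayι_preimage_basicOpen (forms 𝕜 W) g.2 one_pos f.2 hd,
      this]
    exact (congrArg (t ⁻¹ᵁ ·) (basicOpen_eq_of_affine (quot g f)).symm).trans
      (Scheme.preimage_basicOpen_top t _)
  rw [← h]
  rfl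

/-- Finitely many points of `ℙ(W)` over an infinite field avoid a common hyperplane. -/
lemma exists_linearForm_forall_notMem [Infinite 𝕜] {ι : Type*} [Finite ι]
    (p : ι → ProjSpace 𝕜 W) :
    ∃ l : Dual 𝕜 W, ∀ i, ofLinearForm 𝕜 W l ∉ (p i).asHomogeneousIdeal := by
  classical
  have := Fintype.ofFinite ι
  let N : ι → Subspace 𝕜 (Dual 𝕜 W) := fun i =>
    ((p i).asHomogeneousIdeal.toIdeal.restrictScalars 𝕜).comap (ofLinearForm 𝕜 W)
  have hN : (⊤ : Subspace 𝕜 (Dual 𝕜 W)) ∉ Finset.univ.image N := by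
    simp only [Finset.mem_image, Finset.mem_univ, true_and, not_exists]
    intro i hi
    obtain ⟨l, hl⟩ := exists_linearForm_notMem (p i)
    have : l ∈ N i := hi ▸ Submodule.mem_top
    exact hl this
  -- Over an infinite field a vector space is not a finite union of proper subspaces.
  have h := Subspace.biUnion_ne_univ_of_top_notMem hN
  obtain ⟨l, hl⟩ := (Set.ne_univ_iff_exists_notMem _).1 h
  refine ⟨l, fun i hi => hl ?_⟩
  simp only [Set.mem_iUnion]
  exact ⟨N i, Finset.mem_image_of_mem _ (Finset.mem_univ i), hi⟩

lemma val_quot {d : ℕ} (f : forms 𝕜 W d) : (quot g f).val =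
    Localization.mk 1 ⟨g.1, Submonoid.mem_powers _⟩ ^ d *
      algebraMap _ (Localization.Away g.1) f.1 := by
  rw [quot, Away.val_mk, Localization.mk_pow, ← Localization.mk_one_eq_algebraMap,
    Localization.mk_mul]
  congr 1
  · simp
  · ext
    simp

/-- Dehomogenization commutes with taking minors. -/
lemma quot_minor {m n : Type*} (M : Matrix m n (Dual 𝕜 W)) {q : ℕ} (a : Fin q ↪ m)
    (b : Fin q ↪ n) : quot g (minor M a b) =
      ((M.map fun l => quot g (linearForm l)).submatrix a b).det := by
  apply val_injective
  rw [val_quot, ← HomogeneousLocalization.algebraMap_apply, RingHom.map_det, minor, RingHom.map_det]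
  have : (algebraMap (Away (forms 𝕜 W) g.1) (Localization.Away g.1)).mapMatrix
      ((M.map fun l => quot g (linearForm l)).submatrix a b) =
      (Localization.mk 1 ⟨g.1, Submonoid.mem_powers _⟩ : Localization.Away g.1) •
        (algebraMap _ (Localization.Away g.1)).mapMatrix
          ((M.map (ofLinearForm 𝕜 W)).submatrix a b) := by
    ext i j
    exact (val_quot g (linearForm (M (a i) (b j)))).trans (by rw [pow_one]; rfl)
  -- Scaling a `q × q` matrix by `1 / g` scales its determinant by `1 / g ^ q`, the power that
  -- dehomogenizes a form of degree `q`.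
  rw [this, Matrix.det_smul, Fintype.card_fin]

lemma quot_add {d : ℕ} (f f' : forms 𝕜 W d) : quot g (f + f') = quot g f + quot g f' := by
  apply val_injective
  rw [val_add, val_quot, val_quot, val_quot, Submodule.coe_add, map_add, mul_add]

lemma quot_smul {d : ℕ} (c : 𝕜) (f : forms 𝕜 W d) : quot g (c • f) =
    fromZeroRingHom (forms 𝕜 W) _ (algebraMap 𝕜 (forms 𝕜 W 0) c) * quot g f := by
  apply val_injective
  rw [val_mul, val_quot, val_quot, Submodule.coe_smul, Algebra.smul_def, map_mul, mul_left_comm]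
  rfl

/-! ### Finite schemes, their spans, and closedness of rank loci. -/

/-- A scheme with finitely many points over `ℙ(W)` lies in `{g ≠ 0}` for some linear form `g`. -/
lemma exists_eq_comp_awayι [Infinite 𝕜] [Finite R] (z : R ⟶ ProjSpace 𝕜 W) :
    ∃ (g : forms 𝕜 W 1) (t : R ⟶ Spec (.of (Away (forms 𝕜 W) g.1))),
      z = t ≫ Proj.awayι (forms 𝕜 W) g.1 g.2 one_pos := by
  obtain ⟨l, hl⟩ := exists_linearForm_forall_notMem (fun x : R => z x)
  refine ⟨linearForm l, IsOpenImmersion.lift (Proj.awayι (forms 𝕜 W) _ _ one_pos) z ?_,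
    (IsOpenImmersion.lift_fac _ _ _).symm⟩
  rw [← Scheme.Hom.coe_opensRange (Proj.awayι _ _ _ _), Proj.opensRange_awayι]
  rintro _ ⟨x, rfl⟩
  exact hl x

lemma finite_of_isArtinianRing [IsAffine R] [IsArtinianRing Γ(R, ⊤)] : Finite R :=
  Finite.of_equiv (PrimeSpectrum Γ(R, ⊤)) R.isoSpec.inv.homeomorph.toEquiv

lemma exists_mem_iff_notMem_basicOpen [IsAffine R] (p : PrimeSpectrum Γ(R, ⊤)) :
    ∃ x : R, ∀ s : Γ(R, ⊤), x ∈ R.basicOpen s ↔ s ∉ p.asIdeal := by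
  refine ⟨R.isoSpec.inv p, fun s => ?_⟩
  have h : R.toSpecΓ (R.isoSpec.inv p) = p :=
    congrArg (fun f : Spec Γ(R, ⊤) ⟶ Spec Γ(R, ⊤) => f p) R.isoSpec.inv_hom_id
  rw [← Scheme.toSpecΓ_preimage_basicOpen]
  change R.toSpecΓ (R.isoSpec.inv p) ∈ PrimeSpectrum.basicOpen s ↔ _
  rw [h]
  rfl

/-- The rank of `M` on the span of a finite scheme of degree `r` contained in `{rk M = k}` is at
most `k * r`. -/
lemma rankAt_le_of_mem_linSpan [Infinite 𝕜] {m n : Type*} [Fintype m] [Fintype n]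
    (M : Matrix m n (Dual 𝕜 W)) (k : ℕ) (z : R ⟶ ProjSpace 𝕜 W)
    [IsFinite (z ≫ ProjSpace.toSpec 𝕜 W)] (hz : InConstantRankLocus M k z) (p : ProjSpace 𝕜 W)
    (hp : p ∈ linSpan z) : rankAt M p ≤ k * degree (z ≫ ProjSpace.toSpec 𝕜 W) := by
  have : IsAffine R := isAffine_of_isAffineHom (z ≫ ProjSpace.toSpec 𝕜 W)
  let : Algebra 𝕜 Γ(R, ⊤) := ((Scheme.ΓSpecIso (.of 𝕜)).inv ≫
    (z ≫ ProjSpace.toSpec 𝕜 W).appTop).hom.toAlgebra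
  have hfin : Module.Finite 𝕜 Γ(R, ⊤) := by
    have h1 := Scheme.Hom.finite_appTop (z ≫ ProjSpace.toSpec 𝕜 W)
    exact h1.comp (RingHom.Finite.of_surjective _
      (ConcreteCategory.bijective_of_isIso (Scheme.ΓSpecIso (.of 𝕜)).inv).2)
  have : IsArtinianRing Γ(R, ⊤) := IsArtinianRing.of_finite 𝕜 _
  have : Finite R := finite_of_isArtinianRing
  obtain ⟨g, t, hgt⟩ := exists_eq_comp_awayι z
  have hsmul (c : 𝕜) : algebraMap 𝕜 Γ(R, ⊤) c =
      pullbackAway g t (fromZeroRingHom (forms 𝕜 W) _ (algebraMap 𝕜 (forms 𝕜 W 0) c)) := by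
    rw [pullbackAway_algebraMap, ← hgt]
    rfl
  let φ : Dual 𝕜 W →ₗ[𝕜] Γ(R, ⊤) :=
    { toFun := fun l => pullbackAway g t (quot g (linearForm l))
      map_add' := fun l l' => by
        rw [← map_add, ← quot_add]
        congr 2
        exact Subtype.ext (map_add _ _ _)
      map_smul' := fun c l => by
        rw [RingHom.id_apply, Algebra.smul_def, hsmul, ← map_mul, ← quot_smul]
        congr 2
        exact Subtype.ext (map_smul _ _ _) }
  have hφ (l : Dual 𝕜 W) : VanishesOn (linearForm l) z ↔ φ l = 0 := by
    rw [hgt]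
    exact vanishesOn_iff_pullbackAway g t _
  have hminor {q : ℕ} (a : Fin q ↪ m) (b : Fin q ↪ n) :
      ((M.map φ).submatrix a b).det = pullbackAway g t (quot g (minor M a b)) := by
    rw [quot_minor, RingHom.map_det]
    rfl
  obtain ⟨P, Q, hPQ⟩ := exists_eq_mul_of_isArtinianRing (M.map φ) (k := k)
    (fun a b => by
      rw [hminor, ← vanishesOn_iff_pullbackAway, ← hgt]
      exact hz.1 a b)
    (fun y => by
      obtain ⟨x, hx⟩ := exists_mem_iff_notMem_basicOpen y
      have : (z x).asHomogeneousIdeal.toIdeal.IsPrime := (z x).isPrime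
      obtain ⟨a, b, hab⟩ := (le_rank_iff_exists_minor _ k).1 (hz.2 x).ge
      refine ⟨a, b, ?_⟩
      -- The comparison of nonvanishing loci needs forms of positive degree; the empty minor is `1`,
      -- which lies in no prime.
      rcases Nat.eq_zero_or_pos k with rfl | hk
      · rw [Matrix.det_isEmpty]
        exact y.asIdeal.ne_top_iff_one.1 y.isPrime.ne_top
      · rw [hminor, ← hx, mem_basicOpen_pullbackAway g t hk, ← hgt]
        exact mt (det_residueField_eq_zero_iff M (z x) a b).2 hab)
  have : p.asHomogeneousIdeal.toIdeal.IsPrime := p.isPrime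
  let ev : Dual 𝕜 W →ₗ[𝕜] p.asHomogeneousIdeal.toIdeal.ResidueField :=
    (IsScalarTower.toAlgHom 𝕜 (CoordRing 𝕜 W) _).toLinearMap ∘ₗ ofLinearForm 𝕜 W
  -- Membership in the span is used here: a form killed by `φ` vanishes on `R`, hence at `p`.
  obtain ⟨f, hf⟩ := exists_comp_eq_of_ker_le φ ev fun l hl =>
    Ideal.algebraMap_residueField_eq_zero.2 (hp l ((hφ l).2 hl))
  have hM : (M.map fun l => algebraMap (CoordRing 𝕜 W)
      p.asHomogeneousIdeal.toIdeal.ResidueField (ofLinearForm 𝕜 W l)) = (P * Q).map f := by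
    rw [← hPQ]
    ext i j
    exact (LinearMap.congr_fun hf (M i j)).symm
  rw [rankAt, hM]
  exact rank_map_mul_le P Q f

/-- The complement is the union of the open sets where some minor of size `q + 1` is nonzero. -/
lemma isClosed_rankLocus {m n : Type*} [Fintype m] [Fintype n] (M : Matrix m n (Dual 𝕜 W))
    (q : ℕ) : IsClosed (rankLocus M q) := by
  have : rankLocus M q = (⋃ (a : Fin (q + 1) ↪ m) (b : Fin (q + 1) ↪ n),
      (Proj.basicOpen (forms 𝕜 W) (minor M a b).1 : Set (ProjSpace 𝕜 W)))ᶜ := by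
    ext p
    have : p.asHomogeneousIdeal.toIdeal.IsPrime := p.isPrime
    rw [← not_iff_not, Set.mem_compl_iff, not_not]
    simp only [Set.mem_iUnion]
    change ¬ (rankAt M p ≤ q) ↔ ∃ a b, (minor M a b).1 ∉ p.asHomogeneousIdeal
    rw [not_le, ← Nat.succ_le_iff, rankAt, le_rank_iff_exists_minor]
    simp only [ne_eq, det_residueField_eq_zero_iff]
  rw [this, isClosed_compl_iff]
  exact isOpen_iUnion fun a => isOpen_iUnion fun b => (Proj.basicOpen _ _).isOpen

lemma InConstantRankLocus.comp {m n : Type*} [Fintype n] {M : Matrix m n (Dual 𝕜 W)} {k : ℕ}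
    {X : Scheme.{u}} {j : X ⟶ ProjSpace 𝕜 W} (h : InConstantRankLocus M k j) (i : R ⟶ X) :
    InConstantRankLocus M k (i ≫ j) :=
  ⟨fun a b => (h.1 a b).comp i, fun x => h.2 (i x)⟩
end Cactus

theorem mainTheorem4 {𝕜 W : Type u} [Field 𝕜] [IsAlgClosed 𝕜] [AddCommGroup W] [Module 𝕜 W]
    [FiniteDimensional 𝕜 W] {m n : Type*} [Fintype m] [Fintype n]
    (M : Matrix m n (Module.Dual 𝕜 W)) (k r : ℕ)
    {X : AlgebraicGeometry.Scheme.{u}} (j : X ⟶ Cactus.ProjSpace 𝕜 W)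
    [AlgebraicGeometry.IsImmersion j] (hX : Cactus.InConstantRankLocus M k j) :
    Cactus.cactus r j ⊆ Cactus.rankLocus M (k * r) := by
  refine closure_minimal ?_ (Cactus.isClosed_rankLocus M _)
  rintro p ⟨R, i, -, hfin, hdeg, hp⟩
  have : Infinite 𝕜 := IsAlgClosed.instInfinite
  have hfin' : IsFinite ((i ≫ j) ≫ Cactus.ProjSpace.toSpec 𝕜 W) := by
    rwa [Category.assoc]
  refine (Cactus.rankAt_le_of_mem_linSpan M k (i ≫ j) (hX.comp i) p hp).trans ?_
  rw [Category.assoc]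
  exact Nat.mul_le_mul_left k hdeg
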